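/- Let $X$ be a complex Banach space, $\mathbb{R}_+=[0,\infty)$, and for $\mathbb{J}\in\{\mathbb{R}_+,\mathbb{R}\}$ let $BUC(\mathbb{J},X)$ be the Banach space of bounded uniformly continuous functions $\mathbb{J}\to X$ with the supremum norm. For $t\in\mathbb{J}$ let $S^{\mathbb{J}}(t)$ be the translation operator on $BUC(\mathbb{J},X)$ given by $(S^{\mathbb{J}}(t)\phi)(s)=\phi(s+t)$, $s\in\mathbb{J}$; for $\phi\in BUC(\mathbb{J},X)$ the orbit $S^{\mathbb{J}}(\cdot)\phi$ is then a bounded continuous function $\mathbb{J}\to BUC(\mathbb{J},X)$. For a complex Banach space $E$ and a bounded continuous function $f:\mathbb{R}_+\to E$ let $\mathcal{L}f(\lambda)=\int_0^\infty e^{-\lambda t}f(t)\,dt$ for $\operatorname{Re}\lambda>0$. For a bounded continuous function $f:\mathbb{R}\to E$ let $\mathcal{C}f(\lambda)=\int_0^\infty e^{-\lambda t}f(t)\,dt$ if $\operatorname{Re}\lambda>0$ and $\mathcal{C}f(\lambda)=-\int_0^\infty e^{\lambda t}f(-t)\,dt$ if $\operatorname{Re}\lambda<0$ (Bochner integrals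 in $E$). A point $i\omega\in i\mathbb{R}$ is a regular point of an $E$-valued function $\zeta$ that is holomorphic on $\{\operatorname{Re}\lambda>0\}$ (respectively on $\mathbb{C}\setminus i\mathbb{R}$) if $\zeta$ has an extension that is holomorphic in a neighbourhood of $i\omega$, and a singular point otherwise. The Laplace spectrum $sp^{\mathcal{L}}(f)$ is the set of all $\omega\in\mathbb{R}$ such that $i\omega$ is a singular point of $\mathcal{L}f$, and the Carleman spectrum $sp^{\mathcal{C}}(f)$ is the set of all $\omega\in\mathbb{R}$ such that $i\omega$ is a singular point of $\mathcal{C}f$. Then $$sp^{\mathcal{L}}(\phi)=sp^{\mathcal{L}}\big(S^{\mathbb{R}_+}(\cdot)\phi\big)\quad\text{for every }\phi\in BUC(\mathbb{R}_+,X),$$ $$sp^{\mathcal{C}}(\phi)=sp^{\mathcal{C}}\big(S^{\mathbb{R}}(\cdot)\phi\big)\quad\text{for every }\phi\in BUC(\mathbb{R},X).$$ -/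

import Mathlib

open scoped NNReal BoundedContinuousFunction

/-- `BUC J X`: the bounded uniformly continuous functions `J → X`, with the supremum norm
(inherited from the space of bounded continuous functions). -/
def BUC (J X : Type*) [PseudoMetricSpace J] [NormedAddCommGroup X] [NormedSpace ℂ X] :
    Submodule ℂ (J →ᵇ X) where
  carrier := {φ | UniformContinuous φ}
  add_mem' hf hg := UniformContinuous.add hf hg
  zero_mem' := uniformContinuous_const
  smul_mem' c _ hf := UniformContinuous.const_smul hf c

theorem BUC.isClosed (J X : Type*) [PseudoMetricSpace J] [NormedAddCommGroup X]
    [NormedSpace ℂ X] : IsClosed (BUC J X : Set (J →ᵇ X)) := by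
  refine isClosed_of_closure_subset fun φ hφ => ?_
  obtain ⟨u, hu, hlim⟩ := mem_closure_iff_seq_limit.1 hφ
  exact (BoundedContinuousFunction.tendsto_iff_tendstoUniformly.1 hlim).uniformContinuous
    (Filter.Frequently.of_forall hu)

/-- `BUC J X` is a Banach space when `X` is one, so that Bochner integrals of functions with
values in it are meaningful. -/
instance BUC.instCompleteSpace (J X : Type*) [PseudoMetricSpace J] [NormedAddCommGroup X]
    [NormedSpace ℂ X] [CompleteSpace X] : CompleteSpace (BUC J X) :=
  (BUC.isClosed J X).completeSpace_coe

theorem uniformContinuous_add_right_of_lipschitzAdd {J : Type*} [PseudoMetricSpace J]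
    [AddMonoid J] [LipschitzAdd J] (t : J) : UniformContinuous fun s : J => s + t :=
  (lipschitzWith_lipschitz_const_add_edist (β := J)).uniformContinuous.comp
    (uniformContinuous_id.prodMk uniformContinuous_const)

/-- The translate `φ_t`, `φ_t (s) = φ (s + t)`, as an element of `BUC J X`. -/
def BUC.translate {J X : Type*} [PseudoMetricSpace J] [AddMonoid J] [LipschitzAdd J]
    [NormedAddCommGroup X] [NormedSpace ℂ X] (t : J) (φ : BUC J X) : BUC J X :=
  ⟨φ.1.compContinuous
      ⟨fun s => s + t, (uniformContinuous_add_right_of_lipschitzAdd t).continuous⟩,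
    UniformContinuous.comp φ.2 (uniformContinuous_add_right_of_lipschitzAdd t)⟩

/-- The translation semigroup (group, when `J = ℝ`): `S t` is the bounded operator
`φ ↦ φ_t` on `BUC J X`, for `t` in `J`. -/
noncomputable def translationSemigroup {J X : Type*} [PseudoMetricSpace J] [AddMonoid J]
    [LipschitzAdd J] [NormedAddCommGroup X] [NormedSpace ℂ X] (t : J) :
    BUC J X →L[ℂ] BUC J X :=
  LinearMap.mkContinuous
    { toFun := BUC.translate t
      map_add' := fun _ _ => rfl
      map_smul' := fun _ _ => rfl } 1
    (fun φ => by
      rw [one_mul]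
      exact (BoundedContinuousFunction.norm_le (norm_nonneg φ)).2
        fun s => φ.1.norm_coe_le_norm (s + t))

section Transforms

variable {E : Type*} [NormedAddCommGroup E] [NormedSpace ℂ E]

open Classical in
/-- A function on `ℝ₊ = [0, ∞)` is identified with its extension by `0` to `ℝ`. -/
noncomputable def extendByZero (f : ℝ≥0 → E) : ℝ → E :=
  fun t => if h : 0 ≤ t then f ⟨t, h⟩ else 0

/-- The Laplace transform `∫₀^∞ e^{-λt} f(t) dt` (a Bochner integral), for `Re λ > 0`. -/
noncomputable def laplaceTransform (f : ℝ → E) (l : ℂ) : E :=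
  ∫ t in Set.Ioi (0 : ℝ), Complex.exp (-l * (t : ℂ)) • f t

/-- The Carleman transform: `∫₀^∞ e^{-λt} f(t) dt` for `Re λ > 0` and
`-∫₀^∞ e^{λt} f(-t) dt` for `Re λ < 0` (on the imaginary axis it is not defined, and the value
`0` given here is never used). -/
noncomputable def carlemanTransform (f : ℝ → E) (l : ℂ) : E :=
  if 0 < l.re then ∫ t in Set.Ioi (0 : ℝ), Complex.exp (-l * (t : ℂ)) • f t
  else if l.re < 0 then -∫ t in Set.Ioi (0 : ℝ), Complex.exp (l * (t : ℂ)) • f (-t)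
  else 0

/-- `z` is a regular point of a function `ζ` that is holomorphic on `D`: on some open
neighbourhood `V` of `z` there is a holomorphic function that agrees with `ζ` on `V ∩ D`. -/
def IsRegularPoint (D : Set ℂ) (ζ : ℂ → E) (z : ℂ) : Prop :=
  ∃ V : Set ℂ, IsOpen V ∧ z ∈ V ∧
    ∃ g : ℂ → E, DifferentiableOn ℂ g V ∧ Set.EqOn g ζ (V ∩ D)

/-- The Laplace spectrum: the real `ω` for which `iω` is a singular point of the Laplace
transform on the open right half-plane. -/
def laplaceSpectrum (f : ℝ → E) : Set ℝ :=
  {ω | ¬ IsRegularPoint {l : ℂ | 0 < l.re} (laplaceTransform f) (Complex.I * (ω : ℂ))}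

/-- The Carleman spectrum: the real `ω` for which `iω` is a singular point of the Carleman
transform on the complement of the imaginary axis. -/
def carlemanSpectrum (f : ℝ → E) : Set ℝ :=
  {ω | ¬ IsRegularPoint {l : ℂ | l.re ≠ 0} (carlemanTransform f) (Complex.I * (ω : ℂ))}

end Transforms

open MeasureTheory Filter Topology Metric

/-! ### Laplace integrals: holomorphy, translation formula and bounds -/

section Prelim

variable {E F : Type*} [NormedAddCommGroup E] [NormedSpace ℂ E]
  [NormedAddCommGroup F] [NormedSpace ℂ F]

/-! Evaluation at `0` carries the transform `H` of the orbit to the transform `h` of `φ`, so regular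
points of `H` are regular for `h`.

Conversely, evaluation at `s` carries `H` to the transform of the translate by `s`, which is `exp (l
s)` times (`h l` minus an entire truncated integral over `[0, s]`). A local extension of `h` thus
extends all these functions to one common disc. The extensions are `O(1 / |Re l|)` uniformly in `s`,
and a Newman-type factor vanishing where the boundary circle meets the imaginary axis turns this
into a uniform bound on a smaller disc (`norm_le_of_norm_mul_abs_re_le`). Since evaluations are
norming, Cauchy estimates pass from the scalar index `s` to the Taylor coefficients of `H` itself,
whose series then extends `H` past the axis (`isRegularPoint_of_norming_family`). -/

theorem differentiableOn_integral_cexp_smul {μ : Measure ℝ} {f : ℝ → E} {D : Set ℂ}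
    (hD : IsOpen D)
    (hf : ∀ l ∈ D, Integrable (fun t : ℝ => Complex.exp (-l * (t : ℂ)) • f t) μ) :
    DifferentiableOn ℂ (fun l => ∫ t : ℝ, Complex.exp (-l * (t : ℂ)) • f t ∂μ) D := by
  intro l hl
  obtain ⟨r, hr, hrD⟩ := Metric.isOpen_iff.1 hD l hl
  -- Differentiation costs a factor `|t| ≤ ε⁻¹ exp (ε |t|)` and moving `l` within the `ε`-ball costs
  -- another `exp (ε |t|)`. As `2 * ε < r`, the integrands at `l ± 2ε` are integrable and dominate
  -- for either sign of `t`.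
  set ε := r / 3 with hε
  have hε0 : 0 < ε := by positivity
  have hmem (c : ℝ) (hc : |c| < r) : l + (c : ℂ) ∈ D := hrD (by
    rw [mem_ball, dist_eq_norm, add_sub_cancel_left, Complex.norm_real]; exact hc)
  have h₁ := hf _ (hmem (2 * ε) (by rw [abs_of_pos (by positivity)]; linarith))
  have h₂ := hf _ (hmem (-(2 * ε)) (by rw [abs_neg, abs_of_pos (by positivity)]; linarith))
  refine (hasDerivAt_integral_of_dominated_loc_of_deriv_le (μ := μ)
    (F := fun l t => Complex.exp (-l * (t : ℂ)) • f t)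
    (F' := fun l t => (-(t : ℂ)) • Complex.exp (-l * (t : ℂ)) • f t)
    (bound := fun t : ℝ => ε⁻¹ * (‖Complex.exp (-(l + ((2 * ε : ℝ) : ℂ)) * (t : ℂ)) • f t‖
      + ‖Complex.exp (-(l + ((-(2 * ε) : ℝ) : ℂ)) * (t : ℂ)) • f t‖))
    (ball_mem_nhds l hε0) ?_ (hf l hl) ?_ ?_ ((h₁.norm.add h₂.norm).const_mul _)
    ?_).2.differentiableAt.differentiableWithinAt
  · filter_upwards [hD.mem_nhds hl] with x hx using (hf x hx).1
  · exact (Continuous.aestronglyMeasurable (by fun_prop)).smul (hf l hl).1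
  · refine Eventually.of_forall fun t x hx => ?_
    have hre : |x.re - l.re| ≤ ε := by
      rw [← Complex.sub_re]
      exact (Complex.abs_re_le_norm _).trans (by rw [← dist_eq_norm]; exact (mem_ball.1 hx).le)
    have key : ε * |t| * Real.exp (-x.re * t) ≤
        Real.exp (-(l.re + 2 * ε) * t) + Real.exp (-(l.re + -(2 * ε)) * t) := by
      have h1 : ε * |t| ≤ Real.exp (ε * |t|) := by linarith [Real.add_one_le_exp (ε * |t|)]
      have h2 : -(x.re - l.re) * t ≤ ε * |t| := by
        refine (le_abs_self _).trans ?_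
        rw [abs_mul, abs_neg]
        gcongr
      have h3 : ε * |t| * Real.exp (-x.re * t) ≤ Real.exp (-l.re * t + 2 * ε * |t|) := by
        refine (mul_le_mul_of_nonneg_right h1 (Real.exp_pos _).le).trans ?_
        rw [← Real.exp_add]
        exact Real.exp_le_exp.2 (by linarith)
      rcases abs_cases t with ⟨h, _⟩ | ⟨h, _⟩
      · have : -l.re * t + 2 * ε * |t| = -(l.re + -(2 * ε)) * t := by rw [h]; ring
        rw [this] at h3
        linarith [Real.exp_pos (-(l.re + 2 * ε) * t)]
      · have : -l.re * t + 2 * ε * |t| = -(l.re + 2 * ε) * t := by rw [h]; ring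
        rw [this] at h3
        linarith [Real.exp_pos (-(l.re + -(2 * ε)) * t)]
    simp only [norm_smul, Complex.norm_exp, norm_neg, Complex.norm_real, Real.norm_eq_abs,
      Complex.re_mul_ofReal, Complex.neg_re, Complex.add_re, Complex.ofReal_re]
    rw [← add_mul, ← mul_assoc, ← mul_assoc]
    refine mul_le_mul_of_nonneg_right ?_ (norm_nonneg _)
    rw [inv_mul_eq_div, le_div_iff₀ hε0]
    linarith
  · refine Eventually.of_forall fun t x _ => ?_
    have h : HasDerivAt (fun x : ℂ => Complex.exp (-x * (t : ℂ)))
        (Complex.exp (-x * (t : ℂ)) * (-1 * (t : ℂ))) x :=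
      (((hasDerivAt_id x).neg).mul_const (t : ℂ)).cexp
    convert h.smul_const (f t) using 1
    rw [smul_smul]
    ring_nf

theorem integrableOn_cexp_smul {f : ℝ → E} {M : ℝ} (hf : Continuous f) (hM : ∀ t, ‖f t‖ ≤ M)
    {l : ℂ} (hl : 0 < l.re) (c : ℝ) :
    IntegrableOn (fun t : ℝ => Complex.exp (-l * (t : ℂ)) • f t) (Set.Ioi c) :=
  Integrable.smul_bdd (integrableOn_exp_mul_complex_Ioi (by simpa using hl) c) M
    hf.aestronglyMeasurable (Eventually.of_forall hM)

theorem norm_laplaceTransform_mul_re_le {f : ℝ → E} {M : ℝ} (hM : ∀ t, ‖f t‖ ≤ M)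
    {l : ℂ} (hl : 0 < l.re) : ‖laplaceTransform f l‖ * l.re ≤ M := by
  have h : ‖laplaceTransform f l‖ ≤ ∫ t in Set.Ioi (0 : ℝ), Real.exp (-l.re * t) * M := by
    refine norm_integral_le_of_norm_le
      ((integrableOn_exp_mul_Ioi (by linarith) 0).mul_const M) (Eventually.of_forall fun t => ?_)
    rw [norm_smul, Complex.norm_exp]
    simp only [Complex.re_mul_ofReal, Complex.neg_re]
    exact mul_le_mul_of_nonneg_left (hM t) (Real.exp_pos _).le
  rw [integral_mul_const, integral_exp_mul_Ioi (by linarith)] at h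
  rw [← le_div_iff₀ hl]
  refine h.trans_eq ?_
  simp
  field_simp

theorem differentiableOn_laplaceTransform {f : ℝ → E} {M : ℝ} (hf : Continuous f)
    (hM : ∀ t, ‖f t‖ ≤ M) : DifferentiableOn ℂ (laplaceTransform f) {l : ℂ | 0 < l.re} :=
  differentiableOn_integral_cexp_smul (isOpen_lt continuous_const Complex.continuous_re)
    fun _ hl => integrableOn_cexp_smul hf hM hl 0

theorem differentiable_intervalIntegral_cexp_smul {f : ℝ → E} (hf : Continuous f) (s : ℝ) :
    Differentiable ℂ fun l => ∫ t in (0 : ℝ)..s, Complex.exp (-l * (t : ℂ)) • f t := by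
  have h (l : ℂ) : IntervalIntegrable (fun t : ℝ => Complex.exp (-l * (t : ℂ)) • f t)
      volume 0 s := Continuous.intervalIntegrable (by fun_prop) _ _
  rw [← differentiableOn_univ]
  exact (differentiableOn_integral_cexp_smul isOpen_univ fun l _ => (h l).1).sub
    (differentiableOn_integral_cexp_smul isOpen_univ fun l _ => (h l).2)

/-- The Laplace transform of a translate, in terms of the transform at the origin. -/
theorem laplaceTransform_comp_const_add {f : ℝ → E} {M : ℝ} (hf : Continuous f)
    (hM : ∀ t, ‖f t‖ ≤ M) {l : ℂ} (hl : 0 < l.re) (s : ℝ) :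
    laplaceTransform (fun t => f (s + t)) l = Complex.exp (l * (s : ℂ)) •
      (laplaceTransform f l - ∫ t in (0 : ℝ)..s, Complex.exp (-l * (t : ℂ)) • f t) := by
  have h₁ : laplaceTransform f l - ∫ t in (0 : ℝ)..s, Complex.exp (-l * (t : ℂ)) • f t =
      ∫ t in Set.Ioi s, Complex.exp (-l * (t : ℂ)) • f t := by
    rw [sub_eq_iff_eq_add', laplaceTransform]
    exact (intervalIntegral.integral_interval_add_Ioi (integrableOn_cexp_smul hf hM hl 0)
      (integrableOn_cexp_smul hf hM hl s)).symm
  have h₂ := (measurePreserving_add_left volume s).setIntegral_preimage_emb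
    (measurableEmbedding_addLeft s) (fun t : ℝ => Complex.exp (-l * (t : ℂ)) • f t) (Set.Ioi s)
  rw [Set.preimage_const_add_Ioi, sub_self] at h₂
  rw [h₁, ← h₂, ← integral_smul, laplaceTransform]
  congr 1 with t
  rw [smul_smul, ← Complex.exp_add]
  congr 2
  push_cast
  ring

theorem ContinuousLinearMap.laplaceTransform_comp [CompleteSpace E] [CompleteSpace F]
    (T : E →L[ℂ] F) {f : ℝ → E} {M : ℝ}
    (hf : Continuous f) (hM : ∀ t, ‖f t‖ ≤ M) {l : ℂ} (hl : 0 < l.re) :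
    laplaceTransform (fun t => T (f t)) l = T (laplaceTransform f l) := by
  rw [laplaceTransform, laplaceTransform,
    ← T.integral_comp_comm (integrableOn_cexp_smul hf hM hl 0)]
  simp only [map_smul]

/-- To the left of the axis the decay of `exp (l s)` compensates the growth of the truncated
integral, so the bound does not depend on `s`. -/
theorem norm_cexp_smul_intervalIntegral_mul_le {f : ℝ → E} {M : ℝ}
    (hM : ∀ t, ‖f t‖ ≤ M) {l : ℂ} (hl : l.re < 0) {s : ℝ} (hs : 0 ≤ s) :
    ‖Complex.exp (l * (s : ℂ)) • ∫ t in (0 : ℝ)..s, Complex.exp (-l * (t : ℂ)) • f t‖ * |l.re|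
      ≤ M := by
  have hM0 : 0 ≤ M := (norm_nonneg _).trans (hM 0)
  have h₁ : ‖∫ t in (0 : ℝ)..s, Complex.exp (-l * (t : ℂ)) • f t‖ ≤
      ∫ t in (0 : ℝ)..s, Real.exp (-l.re * t) * M := by
    refine intervalIntegral.norm_integral_le_of_norm_le hs (Eventually.of_forall fun t _ => ?_)
      (Continuous.intervalIntegrable (by fun_prop) _ _)
    rw [norm_smul, Complex.norm_exp]
    simp only [Complex.re_mul_ofReal, Complex.neg_re]
    exact mul_le_mul_of_nonneg_left (hM t) (Real.exp_pos _).le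
  have h₂ : ∫ t in (0 : ℝ)..s, Real.exp (-l.re * t) * M =
      (-l.re)⁻¹ * (Real.exp (-l.re * s) - 1) * M := by
    rw [intervalIntegral.integral_mul_const, intervalIntegral.integral_comp_mul_left
      (fun t => Real.exp t) (by linarith : -l.re ≠ 0), integral_exp]
    simp
  rw [h₂] at h₁
  rw [norm_smul, Complex.norm_exp, Complex.re_mul_ofReal, abs_of_neg hl]
  have hl' : (0 : ℝ) < -l.re := by linarith
  calc _ ≤ Real.exp (l.re * s) * ((-l.re)⁻¹ * (Real.exp (-l.re * s) - 1) * M) * (-l.re) := by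
        gcongr
    _ = (Real.exp (l.re * s) * Real.exp (-l.re * s) - Real.exp (l.re * s)) * M := by
        have := hl.ne
        field_simp
    _ ≤ 1 * M := by
        refine mul_le_mul_of_nonneg_right ?_ hM0
        rw [← Real.exp_add]
        have : l.re * s + -l.re * s = 0 := by ring
        rw [this, Real.exp_zero]
        linarith [Real.exp_pos (l.re * s)]
    _ = M := one_mul M

/-! ### Extension across the imaginary axis -/

/-- A holomorphic function on a disc centred on the imaginary axis that is `O(1 / |Re l|)` on the
boundary circle is bounded, uniformly, on the disc of half the radius. -/
theorem norm_le_of_norm_mul_abs_re_le {f : ℂ → E} {z : ℂ} (hz : z.re = 0) {R B : ℝ} (hR : 0 < R)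
    (hf : DifferentiableOn ℂ f (closedBall z R))
    (hB : ∀ l ∈ sphere z R, ‖f l‖ * |l.re| ≤ B) {l : ℂ} (hl : l ∈ ball z (R / 2)) :
    ‖f l‖ ≤ 8 / 3 * (B / R) := by
  -- On the circle this factor has modulus exactly `2 |Re l| / R`, cancelling the blow-up; on the
  -- half disc it is at least `3 / 4`, whence the constant `8 / 3`.
  set h : ℂ → E := fun l => (1 + ((l - z) / R) ^ 2) • f l with hh
  have hR' : (R : ℂ) ≠ 0 := by exact_mod_cast hR.ne'
  have hd : DiffContOnCl ℂ h (ball z R) := by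
    refine DifferentiableOn.diffContOnCl ?_
    rw [closure_ball z hR.ne']
    exact DifferentiableOn.smul (by fun_prop) hf
  have hbd : ∀ w ∈ frontier (ball z R), ‖h w‖ ≤ 2 * (B / R) := by
    intro w hw
    rw [frontier_ball z hR.ne'] at hw
    have hn : ‖w - z‖ = R := mem_sphere_iff_norm.1 hw
    have hre : (w - z).re = w.re := by rw [Complex.sub_re, hz, sub_zero]
    have h1 : (1 + ((w - z) / R) ^ 2 : ℂ) = (w - z) * ((2 * w.re : ℝ) : ℂ) / R ^ 2 := by
      rw [← hre, ← Complex.add_conj, mul_add, Complex.mul_conj, Complex.normSq_eq_norm_sq, hn]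
      push_cast
      field_simp
      ring
    have h2 : ‖(1 + ((w - z) / R) ^ 2 : ℂ)‖ = 2 * |w.re| / R := by
      rw [h1, norm_div, norm_mul, hn, Complex.norm_real, norm_pow, Complex.norm_real,
        Real.norm_eq_abs, Real.norm_eq_abs, abs_mul, abs_of_pos hR, abs_two]
      field_simp
    rw [hh, norm_smul, h2]
    have := hB w hw
    calc 2 * |w.re| / R * ‖f w‖ = 2 * (‖f w‖ * |w.re|) / R := by ring
      _ ≤ 2 * B / R := by gcongr
      _ = 2 * (B / R) := by ring
  have hle : ‖h l‖ ≤ 2 * (B / R) :=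
    Complex.norm_le_of_forall_mem_frontier_norm_le isBounded_ball hd hbd
      (subset_closure (ball_subset_ball (by linarith) hl))
  have h3 : ‖((l - z) / R) ^ 2‖ ≤ 1 / 4 := by
    have : ‖(l - z) / R‖ ≤ 1 / 2 := by
      rw [norm_div, Complex.norm_real, Real.norm_eq_abs, abs_of_pos hR, div_le_iff₀ hR]
      linarith [mem_ball_iff_norm.1 hl]
    rw [norm_pow]
    nlinarith [norm_nonneg ((l - z) / R)]
  have h4 : 3 / 4 ≤ ‖1 + ((l - z) / R) ^ 2‖ := by
    have := norm_sub_norm_le (1 : ℂ) (-((l - z) / R) ^ 2)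
    rw [norm_neg, sub_neg_eq_add, norm_one] at this
    linarith
  rw [hh, norm_smul] at hle
  nlinarith [norm_nonneg (f l)]

/-- If `T` is a norming family of operators and the functions `T i ∘ H` have holomorphic extensions
to a common ball around `z` that are uniformly bounded, then `z` is a regular point of `H`. -/
theorem isRegularPoint_of_norming_family [CompleteSpace E] [CompleteSpace F] {ι : Type*}
    (T : ι → E →L[ℂ] F) (hT : ∀ (x : E) (C : ℝ), 0 ≤ C → (∀ i, ‖T i x‖ ≤ C) → ‖x‖ ≤ C)
    {D : Set ℂ} (hD : IsOpen D) {H : ℂ → E} (hH : DifferentiableOn ℂ H D) {z : ℂ}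
    (hz : z ∈ closure D) {ρ K : ℝ} (hρ : 0 < ρ) (hK : 0 ≤ K) (G : ι → ℂ → F)
    (hG : ∀ i, DifferentiableOn ℂ (G i) (ball z ρ)) (hGK : ∀ i, ∀ l ∈ ball z ρ, ‖G i l‖ ≤ K)
    (hGH : ∀ i, ∀ l ∈ ball z ρ ∩ D, G i l = T i (H l)) : IsRegularPoint D H z := by
  -- Expand at `c ∈ D` so close to `z` that the disc of radius `3ρ/4` about `c` stays in `ball z ρ`,
  -- while that of radius `ρ/2` contains `z`; the ratio `2/3` makes the Taylor series converge.
  obtain ⟨c, hcD, hc⟩ := Metric.mem_closure_iff.1 hz (ρ / 4) (by positivity)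
  have hsub : closedBall c (3 / 4 * ρ) ⊆ ball z ρ := fun l hl => by
    rw [mem_closedBall] at hl
    rw [mem_ball]
    linarith [dist_triangle l c z, dist_comm z c]
  have hsub' : ball c (ρ / 2) ⊆ ball z ρ :=
    (ball_subset_closedBall.trans (closedBall_subset_closedBall (by linarith))).trans hsub
  have hcz : c ∈ ball z ρ := hsub (mem_closedBall_self (by positivity))
  have hder (i : ι) (n : ℕ) : T i (iteratedDeriv n H c) = iteratedDeriv n (G i) c := by
    have h1 : G i =ᶠ[𝓝 c] T i ∘ H := by
      filter_upwards [(isOpen_ball.inter hD).mem_nhds ⟨hcz, hcD⟩] with l hl using hGH i l hl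
    rw [h1.iteratedDeriv_eq n, iteratedDeriv, iteratedDeriv,
      ContinuousLinearMap.iteratedFDeriv_comp_left (n := n) (T i)
        ((hH.analyticAt (hD.mem_nhds hcD)).contDiffAt) le_rfl]
    rfl
  have hbound (n : ℕ) : ‖iteratedDeriv n H c‖ ≤ n.factorial * K / (3 / 4 * ρ) ^ n := by
    refine hT _ _ (by positivity) fun i => ?_
    rw [hder]
    refine Complex.norm_iteratedDeriv_le_of_forall_mem_sphere_norm_le n (by positivity) ?_
      fun l hl => hGK i l (hsub (sphere_subset_closedBall hl))
    exact ((hG i).mono ((closure_mono ball_subset_closedBall).trans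
      (isClosed_closedBall.closure_eq.subset.trans hsub))).diffContOnCl
  have hterm (n : ℕ) (l : ℂ) (hl : l ∈ ball c (ρ / 2)) :
      ‖(n.factorial : ℂ)⁻¹ • (l - c) ^ n • iteratedDeriv n H c‖ ≤ K * (2 / 3) ^ n := by
    have h1 : ‖l - c‖ ≤ ρ / 2 := (mem_ball_iff_norm.1 hl).le
    have h2 : (0 : ℝ) < n.factorial := by positivity
    rw [norm_smul, norm_smul, norm_inv, Complex.norm_natCast, norm_pow]
    calc _ ≤ (n.factorial : ℝ)⁻¹ * ((ρ / 2) ^ n * (n.factorial * K / (3 / 4 * ρ) ^ n)) := by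
          gcongr
          exact hbound n
      _ = K * ((ρ / 2) / (3 / 4 * ρ)) ^ n := by
          have : 0 < (3 / 4 * ρ) ^ n := by positivity
          rw [div_pow (ρ / 2) (3 / 4 * ρ)]
          field_simp
      _ = K * (2 / 3) ^ n := by
          congr 2
          field_simp
          norm_num
  have hsum : Summable fun n : ℕ => K * (2 / 3 : ℝ) ^ n :=
    (summable_geometric_of_lt_one (by norm_num) (by norm_num)).mul_left K
  refine ⟨ball c (ρ / 2), isOpen_ball, by rw [mem_ball]; linarith,
    fun l => ∑' n : ℕ, (n.factorial : ℂ)⁻¹ • (l - c) ^ n • iteratedDeriv n H c,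
    Complex.differentiableOn_tsum_of_summable_norm hsum (fun n => by fun_prop) isOpen_ball hterm,
    fun l hl => ?_⟩
  have hs := (Summable.of_norm_bounded hsum fun n => hterm n l hl.1).hasSum
  -- `V ∩ D` need not be connected, so the identity theorem is not available; instead the norming
  -- family separates points, and each `T i ∘ H` equals `G i`, the sum of its own Taylor series.
  rw [← sub_eq_zero, ← norm_le_zero_iff]
  refine hT _ 0 le_rfl fun i => ?_
  rw [map_sub, norm_le_zero_iff, sub_eq_zero, ← hGH i l ⟨hsub' hl.1, hl.2⟩]
  refine ((T i).hasSum hs).unique ?_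
  simp only [map_smul, hder]
  exact Complex.hasSum_taylorSeries_on_ball ((hG i).mono hsub') hl.1

theorem IsRegularPoint.clm_comp {D : Set ℂ} {H : ℂ → E} {h : ℂ → F} {z : ℂ} (T : E →L[ℂ] F)
    (hH : IsRegularPoint D H z) (hTH : ∀ l ∈ D, T (H l) = h l) : IsRegularPoint D h z := by
  obtain ⟨V, hV, hzV, g, hg, hgH⟩ := hH
  refine ⟨V, hV, hzV, fun l => T (g l), T.differentiable.comp_differentiableOn hg, fun l hl =>
    (congrArg T (hgH hl)).trans (hTH l hl.2)⟩

end Prelim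

theorem mem_closure_re_pos {z : ℂ} (hz : z.re = 0) : z ∈ closure {l : ℂ | 0 < l.re} := by
  refine Metric.mem_closure_iff.2 fun ε hε => ⟨z + ((ε / 2 : ℝ) : ℂ), ?_, ?_⟩
  · change 0 < (z + ((ε / 2 : ℝ) : ℂ)).re
    rw [Complex.add_re, hz, Complex.ofReal_re]
    linarith
  · rw [dist_eq_norm, sub_add_cancel_left, norm_neg, Complex.norm_real, Real.norm_eq_abs,
      abs_of_pos (by linarith)]
    linarith

/-- Suppose that each `T i ∘ H` is obtained from `h` by subtracting the truncated transform of `f`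
at `σ i` and multiplying by `exp (l σ i)`, for a norming family `T`. If the extensions that a local
extension of `h` gives rise to are `O(1 / |Re l|)` uniformly in `i`, then regular points of `h` on
the imaginary axis are regular points of `H`. -/
theorem isRegularPoint_of_cexp_smul {E F : Type*} [NormedAddCommGroup E] [NormedSpace ℂ E]
    [NormedAddCommGroup F] [NormedSpace ℂ F] [CompleteSpace E] [CompleteSpace F] {ι : Type*}
    (T : ι → E →L[ℂ] F) (hT : ∀ (x : E) (C : ℝ), 0 ≤ C → (∀ i, ‖T i x‖ ≤ C) → ‖x‖ ≤ C)
    (σ : ι → ℝ) {f : ℝ → F} (hf : Continuous f)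
    {D : Set ℂ} (hD : IsOpen D) {H : ℂ → E} (hH : DifferentiableOn ℂ H D) {h : ℂ → F}
    {M : ℝ} {z : ℂ} (hz : z ∈ closure D) (hz0 : z.re = 0)
    (hTH : ∀ i, ∀ l ∈ D, T i (H l) = Complex.exp (l * (σ i : ℂ)) •
      (h l - ∫ t in (0 : ℝ)..σ i, Complex.exp (-l * (t : ℂ)) • f t))
    (hbound : ∀ (V : Set ℂ) (g : ℂ → F) (A : ℝ), Set.EqOn g h (V ∩ D) → (∀ l ∈ V, ‖g l‖ ≤ A) →
      ∀ i, ∀ l ∈ V, l.re ≠ 0 → ‖Complex.exp (l * (σ i : ℂ)) •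
        (g l - ∫ t in (0 : ℝ)..σ i, Complex.exp (-l * (t : ℂ)) • f t)‖ * |l.re|
          ≤ M + A * |l.re|)
    (hreg : IsRegularPoint D h z) : IsRegularPoint D H z := by
  obtain ⟨V, hV, hzV, g, hg, hgh⟩ := hreg
  obtain ⟨R, hR, hRV⟩ := Metric.nhds_basis_closedBall.mem_iff.1 (hV.mem_nhds hzV)
  obtain ⟨A, hA⟩ := (isCompact_closedBall z R).exists_bound_of_continuousOn
    (hg.continuousOn.mono hRV)
  have hA0 : 0 ≤ A := (norm_nonneg _).trans (hA z (mem_closedBall_self hR.le))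
  set G : ι → ℂ → F := fun i l => Complex.exp (l * (σ i : ℂ)) •
    (g l - ∫ t in (0 : ℝ)..σ i, Complex.exp (-l * (t : ℂ)) • f t) with hGdef
  have hG (i : ι) : DifferentiableOn ℂ (G i) (closedBall z R) :=
    DifferentiableOn.smul (by fun_prop) ((hg.mono hRV).sub
      (differentiable_intervalIntegral_cexp_smul hf (σ i)).differentiableOn)
  have hGK (i : ι) (l : ℂ) (hl : l ∈ ball z (R / 2)) :
      ‖G i l‖ ≤ 8 / 3 * (max 0 (M + A * R) / R) := by
    -- Where the circle meets the axis the weighted bound only says `0 ≤ B`, which the `max 0`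
    -- secures.
    refine norm_le_of_norm_mul_abs_re_le hz0 hR (hG i) (fun w hw => ?_) hl
    by_cases hw0 : w.re = 0
    · rw [hw0, abs_zero, mul_zero]
      exact le_max_left _ _
    · have hwR : |w.re| ≤ R := by
        have h1 : (w - z).re = w.re := by rw [Complex.sub_re, hz0, sub_zero]
        rw [← h1]
        exact (Complex.abs_re_le_norm _).trans (mem_sphere_iff_norm.1 hw).le
      refine (hbound (closedBall z R) g A (fun l hl => hgh ⟨hRV hl.1, hl.2⟩) hA i w
        (sphere_subset_closedBall hw) hw0).trans (le_trans ?_ (le_max_right _ _))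
      gcongr
  have hsub : ball z (R / 2) ⊆ closedBall z R :=
    (ball_subset_ball (by linarith)).trans ball_subset_closedBall
  refine isRegularPoint_of_norming_family T hT hD hH hz (half_pos hR) (by positivity) G
    (fun i => (hG i).mono hsub) hGK fun i l hl => ?_
  rw [hTH i l hl.2, hGdef]
  simp only
  rw [hgh ⟨hRV (hsub hl.1), hl.2⟩]

/-! ### Evaluations and orbits in `BUC J X` -/

namespace BUC

variable {J X : Type*} [PseudoMetricSpace J] [NormedAddCommGroup X] [NormedSpace ℂ X]

/-- Evaluation at a point, as a bounded operator on `BUC J X`. -/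
noncomputable def evalCLM (s : J) : BUC J X →L[ℂ] X :=
  (BoundedContinuousFunction.evalCLM ℂ s).comp (BUC J X).subtypeL

theorem norm_le_of_forall_norm_evalCLM_le (φ : BUC J X) (C : ℝ) (hC : 0 ≤ C)
    (h : ∀ s, ‖evalCLM s φ‖ ≤ C) : ‖φ‖ ≤ C :=
  (BoundedContinuousFunction.norm_le hC).2 h

variable [AddMonoid J] [LipschitzAdd J]

theorem evalCLM_translationSemigroup (s t : J) (φ : BUC J X) :
    evalCLM s (translationSemigroup t φ) = (φ : J →ᵇ X) (s + t) := rfl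

theorem norm_translationSemigroup_apply_le (t : J) (φ : BUC J X) :
    ‖translationSemigroup t φ‖ ≤ ‖φ‖ :=
  (BoundedContinuousFunction.norm_le (norm_nonneg φ)).2 fun s => φ.1.norm_coe_le_norm (s + t)

/-- Uniform continuity of `φ` is what makes the modulus uniform in the evaluation point, hence a
bound in supremum norm. -/
theorem continuous_translationSemigroup_apply (φ : BUC J X) :
    Continuous fun t : J => translationSemigroup t φ := by
  have huc : UniformContinuous fun p : J × J => (φ : J →ᵇ X) (p.1 + p.2) :=
    UniformContinuous.comp φ.2 (lipschitzWith_lipschitz_const_add_edist (β := J)).uniformContinuous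
  refine Metric.continuous_iff.2 fun t ε hε => ?_
  obtain ⟨δ, hδ, h⟩ := Metric.uniformContinuous_iff.1 huc (ε / 2) (half_pos hε)
  refine ⟨δ, hδ, fun u hu => lt_of_le_of_lt ?_ (half_lt_self hε)⟩
  exact (BoundedContinuousFunction.dist_le (half_pos hε).le).2 fun s =>
    (h (a := (s, u)) (b := (s, t)) (by simpa [Prod.dist_eq, hδ] using hu)).le

end BUC

/-! ### Laplace spectrum on the half-line -/

section Spectra

variable {X : Type*} [NormedAddCommGroup X] [NormedSpace ℂ X]

/-- Only positive times enter the transform, so the possible jump at `0` can be avoided by extending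
with the constant `f 0` to the left. -/
theorem laplaceTransform_extendByZero (f : ℝ≥0 → X) :
    laplaceTransform (extendByZero f) = laplaceTransform fun t => f t.toNNReal := by
  ext l
  refine setIntegral_congr_fun measurableSet_Ioi fun t ht => ?_
  have ht' : 0 ≤ t := (Set.mem_Ioi.1 ht).le
  simp only [extendByZero, dif_pos ht', Real.toNNReal_of_nonneg ht']
  rfl

theorem laplaceSpectrum_eq_laplaceSpectrum_orbit [CompleteSpace X] (φ : BUC ℝ≥0 X) :
    laplaceSpectrum (extendByZero fun t : ℝ≥0 => (φ : ℝ≥0 →ᵇ X) t) =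
      laplaceSpectrum (extendByZero fun t : ℝ≥0 => translationSemigroup t φ) := by
  set f : ℝ → X := fun t => (φ : ℝ≥0 →ᵇ X) t.toNNReal with hf_def
  set u : ℝ → BUC ℝ≥0 X := fun t => translationSemigroup t.toNNReal φ with hu_def
  have hf : Continuous f := φ.1.continuous.comp continuous_real_toNNReal
  have hfM (t : ℝ) : ‖f t‖ ≤ ‖φ‖ := φ.1.norm_coe_le_norm _
  have hu : Continuous u :=
    (BUC.continuous_translationSemigroup_apply φ).comp continuous_real_toNNReal
  have huM (t : ℝ) : ‖u t‖ ≤ ‖φ‖ := BUC.norm_translationSemigroup_apply_le _ φ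
  have heval (s : ℝ≥0) {l : ℂ} (hl : 0 < l.re) :
      BUC.evalCLM s (laplaceTransform u l) = laplaceTransform (fun t => f (s + t)) l := by
    rw [← (BUC.evalCLM s).laplaceTransform_comp hu huM hl]
    refine setIntegral_congr_fun measurableSet_Ioi fun t ht => ?_
    have ht' : 0 ≤ t := (Set.mem_Ioi.1 ht).le
    simp only [hu_def, hf_def, BUC.evalCLM_translationSemigroup,
      Real.toNNReal_add s.coe_nonneg ht', Real.toNNReal_coe]
  ext ω
  rw [laplaceSpectrum, laplaceSpectrum, Set.mem_ofPred_eq, Set.mem_ofPred_eq, not_iff_not,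
    laplaceTransform_extendByZero, laplaceTransform_extendByZero]
  have hω : (Complex.I * (ω : ℂ)).re = 0 := by simp
  refine ⟨fun h => ?_, fun h => h.clm_comp (BUC.evalCLM 0) fun l hl => ?_⟩
  · refine isRegularPoint_of_cexp_smul (E := BUC ℝ≥0 X) (F := X) (M := ‖φ‖)
      (fun s => BUC.evalCLM s)
      BUC.norm_le_of_forall_norm_evalCLM_le (fun s : ℝ≥0 => (s : ℝ)) hf
      (isOpen_lt continuous_const Complex.continuous_re) (differentiableOn_laplaceTransform hu huM)
      (mem_closure_re_pos hω) hω
      (fun s l hl => (heval s hl).trans (laplaceTransform_comp_const_add hf hfM hl s)) ?_ h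
    intro V g A hg hA s l hl hl0
    have hA0 : 0 ≤ A := (norm_nonneg _).trans (hA l hl)
    -- On the left `g` is unrelated to a transform, but `s ≥ 0` gives `|exp (l s)| ≤ 1`, so its two
    -- terms are bounded separately. On the right the expression is the transform of a translate.
    rcases lt_or_gt_of_ne hl0 with hneg | hpos
    · rw [smul_sub]
      refine (mul_le_mul_of_nonneg_right (norm_sub_le _ _) (abs_nonneg _)).trans ?_
      rw [add_mul, add_comm]
      refine add_le_add (norm_cexp_smul_intervalIntegral_mul_le hfM hneg s.coe_nonneg)
        (mul_le_mul_of_nonneg_right ?_ (abs_nonneg _))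
      rw [norm_smul, Complex.norm_exp, Complex.re_mul_ofReal]
      refine (mul_le_mul (Real.exp_le_one_iff.2
        (mul_nonpos_of_nonpos_of_nonneg hneg.le s.coe_nonneg)) (hA l hl) (norm_nonneg _)
        zero_le_one).trans_eq (one_mul A)
    · rw [hg ⟨hl, hpos⟩, ← laplaceTransform_comp_const_add hf hfM hpos, abs_of_pos hpos]
      exact (norm_laplaceTransform_mul_re_le (fun t => hfM _) hpos).trans
        (le_add_of_nonneg_right (by positivity))
  · simpa using heval 0 hl

/-! ### Carleman spectrum on the line -/

section Carleman

variable {f : ℝ → X} {l : ℂ}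

theorem carlemanTransform_of_pos (hl : 0 < l.re) :
    carlemanTransform f l = laplaceTransform f l := if_pos hl

theorem carlemanTransform_of_neg (hl : l.re < 0) :
    carlemanTransform f l = -laplaceTransform (fun t => f (-t)) (-l) := by
  rw [carlemanTransform, if_neg hl.not_gt, if_pos hl, laplaceTransform, neg_neg]

variable {M : ℝ}

theorem differentiableOn_carlemanTransform (hf : Continuous f) (hM : ∀ t, ‖f t‖ ≤ M) :
    DifferentiableOn ℂ (carlemanTransform f) {l : ℂ | l.re ≠ 0} := by
  intro l hl
  refine DifferentiableAt.differentiableWithinAt ?_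
  rcases lt_or_gt_of_ne (show l.re ≠ 0 from hl) with hneg | hpos
  · have hopen : IsOpen {l : ℂ | l.re < 0} := isOpen_lt Complex.continuous_re continuous_const
    have hd : DifferentiableOn ℂ (fun l => -laplaceTransform (fun t => f (-t)) (-l))
        {l : ℂ | l.re < 0} :=
      ((differentiableOn_laplaceTransform (hf.comp continuous_neg) fun t => hM _).comp
        differentiable_neg.differentiableOn fun l hl => by simpa using hl).neg
    exact (hd.congr fun l hl => carlemanTransform_of_neg hl).differentiableAt (hopen.mem_nhds hneg)
  · have hopen : IsOpen {l : ℂ | 0 < l.re} := isOpen_lt continuous_const Complex.continuous_re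
    exact ((differentiableOn_laplaceTransform hf hM).congr fun l hl =>
      carlemanTransform_of_pos hl).differentiableAt (hopen.mem_nhds hpos)

theorem norm_carlemanTransform_mul_abs_re_le (hM : ∀ t, ‖f t‖ ≤ M) (hl : l.re ≠ 0) :
    ‖carlemanTransform f l‖ * |l.re| ≤ M := by
  rcases lt_or_gt_of_ne hl with hneg | hpos
  · rw [carlemanTransform_of_neg hneg, norm_neg, abs_of_neg hneg]
    exact norm_laplaceTransform_mul_re_le (l := -l) (fun t => hM _) (by simpa using hneg)
  · rw [carlemanTransform_of_pos hpos, abs_of_pos hpos]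
    exact norm_laplaceTransform_mul_re_le hM hpos

/-- The Carleman transform of a translate, in terms of the transform at the origin. -/
theorem carlemanTransform_comp_const_add (hf : Continuous f) (hM : ∀ t, ‖f t‖ ≤ M)
    (hl : l.re ≠ 0) (s : ℝ) :
    carlemanTransform (fun t => f (s + t)) l = Complex.exp (l * (s : ℂ)) •
      (carlemanTransform f l - ∫ t in (0 : ℝ)..s, Complex.exp (-l * (t : ℂ)) • f t) := by
  rcases lt_or_gt_of_ne hl with hneg | hpos
  · rw [carlemanTransform_of_neg hneg, carlemanTransform_of_neg hneg]
    -- Reflection `t ↦ -t` reverses the direction of translation, hence the shift `-s`.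
    have h := laplaceTransform_comp_const_add (f := fun t => f (-t)) (hf.comp continuous_neg)
      (fun t => hM _) (l := -l) (by simpa using hneg) (-s)
    have hint : ∫ t in (0 : ℝ)..(-s), Complex.exp (-(-l) * (t : ℂ)) • f (-t) =
        -∫ t in (0 : ℝ)..s, Complex.exp (-l * (t : ℂ)) • f t := by
      have := intervalIntegral.integral_comp_neg (a := 0) (b := -s)
        (fun t : ℝ => Complex.exp (-l * (t : ℂ)) • f t)
      rw [neg_neg, neg_zero, intervalIntegral.integral_symm 0 s] at this
      rw [← this]
      congr 1 with t
      push_cast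
      ring_nf
    rw [hint] at h
    simp only [neg_add, neg_neg, Complex.ofReal_neg, neg_mul_neg] at h
    rw [h, ← smul_neg]
    congr 1
    abel
  · rw [carlemanTransform_of_pos hpos, carlemanTransform_of_pos hpos]
    exact laplaceTransform_comp_const_add hf hM hpos s

theorem ContinuousLinearMap.carlemanTransform_comp [CompleteSpace X] {E : Type*}
    [NormedAddCommGroup E] [NormedSpace ℂ E] [CompleteSpace E] (T : E →L[ℂ] X) {f : ℝ → E} (hf : Continuous f)
    (hM : ∀ t, ‖f t‖ ≤ M) (hl : l.re ≠ 0) :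
    carlemanTransform (fun t => T (f t)) l = T (carlemanTransform f l) := by
  rcases lt_or_gt_of_ne hl with hneg | hpos
  · rw [carlemanTransform_of_neg hneg, carlemanTransform_of_neg hneg, map_neg]
    exact congrArg _ (T.laplaceTransform_comp (hf.comp continuous_neg) (fun t => hM _)
      (by simpa using hneg))
  · rw [carlemanTransform_of_pos hpos, carlemanTransform_of_pos hpos]
    exact T.laplaceTransform_comp hf hM hpos

end Carleman

theorem carlemanSpectrum_eq_carlemanSpectrum_orbit [CompleteSpace X] (φ : BUC ℝ X) :
    carlemanSpectrum (fun t : ℝ => (φ : ℝ →ᵇ X) t) =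
      carlemanSpectrum (fun t : ℝ => translationSemigroup t φ) := by
  have hf : Continuous (φ : ℝ →ᵇ X) := φ.1.continuous
  have hfM (t : ℝ) : ‖(φ : ℝ →ᵇ X) t‖ ≤ ‖φ‖ := φ.1.norm_coe_le_norm t
  have hu := BUC.continuous_translationSemigroup_apply φ
  have huM (t : ℝ) := BUC.norm_translationSemigroup_apply_le t φ
  have heval (s : ℝ) {l : ℂ} (hl : l.re ≠ 0) :
      BUC.evalCLM s (carlemanTransform (fun t : ℝ => translationSemigroup t φ) l) =
        carlemanTransform (fun t => (φ : ℝ →ᵇ X) (s + t)) l :=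
    ((BUC.evalCLM s).carlemanTransform_comp hu huM hl).symm
  ext ω
  rw [carlemanSpectrum, carlemanSpectrum, Set.mem_ofPred_eq, Set.mem_ofPred_eq, not_iff_not]
  have hsub : {l : ℂ | 0 < l.re} ⊆ {l : ℂ | l.re ≠ 0} :=
    Set.ofPred_subset_ofPred.2 fun l hl => hl.ne'
  have hω : (Complex.I * (ω : ℂ)).re = 0 := by simp
  refine ⟨fun h => ?_, fun h => h.clm_comp (BUC.evalCLM 0) fun l hl => ?_⟩
  · refine isRegularPoint_of_cexp_smul (E := BUC ℝ X) (F := X) (M := ‖φ‖)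
      (fun s => BUC.evalCLM s)
      BUC.norm_le_of_forall_norm_evalCLM_le id hf
      (D := {l : ℂ | l.re ≠ 0})
      (isOpen_ne_fun Complex.continuous_re continuous_const)
      (differentiableOn_carlemanTransform hu huM)
      (closure_mono hsub (mem_closure_re_pos hω)) hω
      (fun s l hl => (heval s hl).trans (carlemanTransform_comp_const_add hf hfM hl s)) ?_ h
    intro V g A hg hA s l hl hl0
    have hA0 : 0 ≤ A := (norm_nonneg _).trans (hA l hl)
    -- Here `g` agrees with the transform on both sides of the axis, so the bound for translates
    -- covers every real `s` without splitting.
    rw [hg ⟨hl, hl0⟩, id, ← carlemanTransform_comp_const_add hf hfM hl0]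
    exact (norm_carlemanTransform_mul_abs_re_le (fun t => hfM _) hl0).trans
      (le_add_of_nonneg_right (by positivity))
  · simpa using heval 0 hl

end Spectra

theorem corollary4p3 {X : Type*} [NormedAddCommGroup X] [NormedSpace ℂ X] [CompleteSpace X] :
    (∀ φ : BUC ℝ≥0 X,
      laplaceSpectrum (extendByZero fun t : ℝ≥0 => (φ : ℝ≥0 →ᵇ X) t) =
        laplaceSpectrum (extendByZero fun t : ℝ≥0 => translationSemigroup t φ)) ∧
    (∀ φ : BUC ℝ X,
      carlemanSpectrum (fun t : ℝ => (φ : ℝ →ᵇ X) t) =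
        carlemanSpectrum (fun t : ℝ => translationSemigroup t φ)) :=
  ⟨laplaceSpectrum_eq_laplaceSpectrum_orbit, carlemanSpectrum_eq_carlemanSpectrum_orbit⟩
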